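/- Let $V:[0,\infty)\to\mathbb R$ be a càdlàg function with finite variation (i.e. of bounded variation on every compact interval). Write $\Delta V(s)=V(s)-V(s-)$, let $V^d(t)=\sum_{0<s\le t}\Delta V(s)$ (an absolutely convergent series) and $V^c=V-V^d$ be the discontinuous and the continuous part of $V$; $V^c$ also has finite variation. Let $V^c(\mathrm ds)$ be its signed Stieltjes measure and $|V^c(\mathrm ds)|$ the total variation measure of the latter. For $t>0$ and Borel $A\subseteq\mathbb R$ put $$\theta_t(A)=\int_0^t \mathbf 1_A(V(s))\,V^c(\mathrm ds),\qquad \vartheta_t(A)=\int_0^t \mathbf 1_A(V(s))\,|V^c(\mathrm ds)|.$$ For $x\in\mathbb R$, let $\mathcal I(x)$ be the set of times $t>0$ such that $V(t)=x$, $V$ is continuous at $t$, and $V(s)-V(t)$ has the same sign ($-$, $0$ or $+$) as $s-t$ for all $s$ in some neighborhood of $t$. Let $\mathcal D(x)$ be the set of times $t>0$ at which $-V$ increases through the level $-x$ in the same sense. Put $$\ell^x(t)=\mathrm{Card}\{(0,t]\cap\mathcal I(x)\}-\mathrm{Card}\{(0,t]\cap\mathcal D(x)\}$$ whenever both cardinalities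 are finite, and $$\lambda^x(t)=\mathrm{Card}\{(0,t]\cap\mathcal I(x)\}+\mathrm{Card}\{(0,t]\cap\mathcal D(x)\}.$$ Then for every $t>0$: both cardinalities are finite for Lebesgue-almost every $x\in\mathbb R$; the almost everywhere defined functions $x\mapsto\ell^x(t)$ and $x\mapsto\lambda^x(t)$ are (Lebesgue) measurable and belong to $L^1(\mathrm dx)$; and $$\theta_t(\mathrm dx)=\ell^x(t)\,\mathrm dx,\qquad \vartheta_t(\mathrm dx)=\lambda^x(t)\,\mathrm dx.$$ -/

import Mathlib

open Set Filter Topology MeasureTheory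
open scoped NNReal ENNReal

noncomputable section

namespace FiniteVariation

/-- A càdlàg function on `[0, ∞)`: right-continuous at every time, with a left limit (in `ℝ`) at
every positive time. -/
structure IsCadlag (V : ℝ≥0 → ℝ) : Prop where
  right_continuous : ∀ t, ContinuousWithinAt V (Ici t) t
  left_limit : ∀ t, 0 < t → ∃ l, Tendsto V (𝓝[<] t) (𝓝 l)

/-- The jump `ΔV(s) = V(s) - V(s-)`. -/
def jump (V : ℝ≥0 → ℝ) (s : ℝ≥0) : ℝ := V s - Function.leftLim V s

/-- The discontinuous part `V^d(t) = ∑_{0 < s ≤ t} ΔV(s)`, the (unordered) sum of all jumps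
up to time `t`. -/
def discontinuousPart (V : ℝ≥0 → ℝ) (t : ℝ≥0) : ℝ := ∑' s : Ioc (0 : ℝ≥0) t, jump V s

/-- The continuous part `V^c = V - V^d`. -/
def continuousPart (V : ℝ≥0 → ℝ) (t : ℝ≥0) : ℝ := V t - discontinuousPart V t

/-- A function with finite variation, stopped at time `t`, has bounded variation. -/
theorem boundedVariationOn_stopped {F : ℝ≥0 → ℝ} (hF : LocallyBoundedVariationOn F univ)
    (t : ℝ≥0) : BoundedVariationOn (fun s => F (min s t)) univ := by
  have h1 : eVariationOn (F ∘ fun s => min s t) univ ≤ eVariationOn F (univ ∩ Icc 0 t) := by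
    apply eVariationOn.comp_le_of_monotoneOn
    · intro a _ b _ hab
      exact min_le_min hab le_rfl
    · intro a _
      exact ⟨mem_univ _, bot_le, min_le_right _ _⟩
  exact ne_top_of_le_ne_top (hF 0 t (mem_univ _) (mem_univ _)) h1

/-- The signed Stieltjes measure `F(ds)` on the time interval `[0, t]` of a function `F` with
finite variation on `[0, ∞)`, seen as a signed measure on `[0, ∞)` which does not charge
`(t, ∞)`: it is the Stieltjes measure of `F` stopped at time `t`. -/
def stieltjesUpTo (F : ℝ≥0 → ℝ) (hF : LocallyBoundedVariationOn F univ) (t : ℝ≥0) :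
    SignedMeasure ℝ≥0 :=
  (boundedVariationOn_stopped hF t).vectorMeasure

/-- The jumps of a càdlàg function with finite variation are absolutely summable on bounded
time intervals. -/
theorem summable_abs_jump {V : ℝ≥0 → ℝ} (hc : IsCadlag V)
    (hV : LocallyBoundedVariationOn V univ) (t : ℝ≥0) :
    Summable ((Ioc 0 t).indicator fun s => |jump V s|) := by
  have hg := boundedVariationOn_stopped hV t
  set g : ℝ≥0 → ℝ := fun s => V (min s t) with hgdef
  have key : ∀ s ∈ Ioc 0 t, hg.vectorMeasure {s} = jump V s := by
    intro s hs
    have hr : Function.rightLim g s = V s := by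
      have : ContinuousWithinAt g (Ici s) s := by
        have h1 : ContinuousWithinAt V (Ici (min s t)) (min s t) := hc.right_continuous _
        refine ContinuousWithinAt.comp (f := fun u : ℝ≥0 => min u t) (g := V) h1 ?_ ?_
        · exact (continuous_id.min continuous_const).continuousWithinAt
        · intro u hu
          exact min_le_min (mem_Ici.1 hu) le_rfl
      rw [this.rightLim_eq]
      simp [hgdef, hs.2]
    have hl : Function.leftLim g s = Function.leftLim V s := by
      obtain ⟨l, hl⟩ := hc.left_limit s hs.1
      have hne : (𝓝[<] s).NeBot := nhdsLT_neBot_of_exists_lt ⟨0, hs.1⟩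
      have hl' : Tendsto g (𝓝[<] s) (𝓝 l) := by
        refine hl.congr' ?_
        filter_upwards [self_mem_nhdsWithin] with u hu
        have : u ≤ t := (le_of_lt hu).trans hs.2
        simp [hgdef, this]
      rw [leftLim_eq_of_tendsto hl, leftLim_eq_of_tendsto hl']
    rw [hg.vectorMeasure_singleton, hr, hl, jump]
  let μ : SignedMeasure ℝ≥0 := hg.vectorMeasure
  refine summable_of_sum_le (c := μ.totalVariation.real univ) (fun s => ?_) (fun u => ?_)
  · exact indicator_nonneg (fun _ _ => abs_nonneg _) s
  · calc ∑ s ∈ u, (Ioc 0 t).indicator (fun s => |jump V s|) s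
        ≤ ∑ s ∈ u, μ.totalVariation.real {s} := by
          refine Finset.sum_le_sum fun s _ => ?_
          by_cases hs : s ∈ Ioc 0 t
          · rw [indicator_of_mem hs, ← key s hs]
            exact SignedMeasure.norm_le_totalVariation μ {s}
          · rw [indicator_of_notMem hs]
            exact measureReal_nonneg
      _ = μ.totalVariation.real u := sum_measureReal_singleton u
      _ ≤ μ.totalVariation.real univ := measureReal_mono (subset_univ _)

theorem locallyBoundedVariationOn_sub {f g : ℝ≥0 → ℝ} (hf : LocallyBoundedVariationOn f univ)
    (hg : LocallyBoundedVariationOn g univ) :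
    LocallyBoundedVariationOn (fun s => f s - g s) univ := by
  intro a b ha hb
  refine ne_top_of_le_ne_top (ENNReal.add_ne_top.2 ⟨hf a b ha hb, hg a b ha hb⟩) ?_
  refine iSup_le fun p => ?_
  calc _ ≤ ∑ i ∈ Finset.range p.1, (edist (f (p.2.1 (i + 1))) (f (p.2.1 i))
          + edist (g (p.2.1 (i + 1))) (g (p.2.1 i))) := by
        refine Finset.sum_le_sum fun i _ => ?_
        simp only [sub_eq_add_neg]
        exact (edist_add_add_le _ _ _ _).trans (by rw [edist_neg_neg])
    _ = _ := Finset.sum_add_distrib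
    _ ≤ _ := add_le_add (eVariationOn.sum_le p.2.2.1 p.2.2.2)
        (eVariationOn.sum_le p.2.2.1 p.2.2.2)

/-- The continuous part of a càdlàg function with finite variation has finite variation. -/
theorem locallyBoundedVariationOn_continuousPart {V : ℝ≥0 → ℝ} (hc : IsCadlag V)
    (hV : LocallyBoundedVariationOn V univ) :
    LocallyBoundedVariationOn (continuousPart V) univ := by
  have hS := summable_abs_jump hc hV
  have hS' : ∀ t, Summable ((Ioc 0 t).indicator (jump V)) := fun t => by
    refine Summable.of_norm_bounded (hS t) fun s => ?_
    rw [norm_indicator_eq_indicator_norm]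
    rfl
  let h : ℝ≥0 → ℝ := fun t => ∑' s, (Ioc 0 t).indicator (fun s => |jump V s|) s
  let k : ℝ≥0 → ℝ := fun t => ∑' s, ((Ioc 0 t).indicator (jump V) s
    + (Ioc 0 t).indicator (fun s => |jump V s|) s)
  have hh : Monotone h := fun a b hab => by
    refine Summable.tsum_le_tsum (fun s => ?_) (hS a) (hS b)
    exact indicator_le_indicator_of_subset (Ioc_subset_Ioc_right hab) (fun _ => abs_nonneg _) s
  have hk : Monotone k := fun a b hab => by
    refine Summable.tsum_le_tsum (fun s => ?_) ((hS' a).add (hS a)) ((hS' b).add (hS b))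
    have h0 : 0 ≤ jump V s + |jump V s| := by linarith [neg_abs_le (jump V s)]
    by_cases ha : s ∈ Ioc 0 a
    · have hb : s ∈ Ioc 0 b := Ioc_subset_Ioc_right hab ha
      simp only [indicator_of_mem ha, indicator_of_mem hb, le_refl]
    · by_cases hb : s ∈ Ioc 0 b
      · simpa only [indicator_of_notMem ha, indicator_of_mem hb, add_zero] using h0
      · simp only [indicator_of_notMem ha, indicator_of_notMem hb, le_refl]
  have hd : discontinuousPart V = fun t => k t - h t := by
    ext t
    have : k t = discontinuousPart V t + h t := by
      simp only [k, h, discontinuousPart]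
      rw [(hS' t).tsum_add (hS t), tsum_subtype]
    rw [this, add_sub_cancel_right]
  have hd' : LocallyBoundedVariationOn (discontinuousPart V) univ := by
    rw [hd]
    exact locallyBoundedVariationOn_sub (hk.monotoneOn _).locallyBoundedVariationOn
      (hh.monotoneOn _).locallyBoundedVariationOn
  exact locallyBoundedVariationOn_sub hV hd'

/-- A function with finite variation is Borel measurable. -/
theorem measurable_of_locallyBoundedVariationOn {V : ℝ≥0 → ℝ}
    (hV : LocallyBoundedVariationOn V univ) : Measurable V := by
  obtain ⟨p, q, hp, hq, rfl⟩ := hV.exists_monotoneOn_sub_monotoneOn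
  exact (monotoneOn_univ.1 hp).measurable.sub (monotoneOn_univ.1 hq).measurable

/-- The signed Stieltjes measure `V^c(ds)` on `[0, t]`. -/
def continuousPartMeasure (V : ℝ≥0 → ℝ) (hc : IsCadlag V)
    (hV : LocallyBoundedVariationOn V univ) (t : ℝ≥0) : SignedMeasure ℝ≥0 :=
  stieltjesUpTo (continuousPart V) (locallyBoundedVariationOn_continuousPart hc hV) t

/-- The signed occupation measure `θ_t(A) = ∫_0^t 1_A(V(s)) V^c(ds)`: the image under `V` of
`V^c(ds)` on `[0, t]`. -/
def signedOccupation (V : ℝ≥0 → ℝ) (hc : IsCadlag V)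
    (hV : LocallyBoundedVariationOn V univ) (t : ℝ≥0) : SignedMeasure ℝ :=
  (continuousPartMeasure V hc hV t).map V

/-- The absolute occupation measure `ϑ_t(A) = ∫_0^t 1_A(V(s)) |V^c(ds)|`: the image under `V` of
the total variation measure `|V^c(ds)|` on `[0, t]`. -/
def absOccupation (V : ℝ≥0 → ℝ) (hc : IsCadlag V)
    (hV : LocallyBoundedVariationOn V univ) (t : ℝ≥0) : Measure ℝ :=
  (continuousPartMeasure V hc hV t).totalVariation.map V

/-- The signed occupation measure as an integral against `V^c(ds)`. -/
theorem signedOccupation_apply {V : ℝ≥0 → ℝ} (hc : IsCadlag V)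
    (hV : LocallyBoundedVariationOn V univ) (t : ℝ≥0) {A : Set ℝ} (hA : MeasurableSet A) :
    signedOccupation V hc hV t A
      = (continuousPartMeasure V hc hV t).integral (fun s => A.indicator (fun _ => (1 : ℝ)) (V s))
          (ContinuousLinearMap.lsmul ℝ ℝ) := by
  have hm := measurable_of_locallyBoundedVariationOn hV
  have : (fun s => A.indicator (fun _ => (1 : ℝ)) (V s)) = (V ⁻¹' A).indicator fun _ => 1 := rfl
  rw [this, VectorMeasure.integral_indicator (hm hA)]
  have hfin : IsFiniteMeasure
      (((continuousPartMeasure V hc hV t).restrict (V ⁻¹' A)).variation) := by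
    rw [← SignedMeasure.totalVariation_eq_variation]
    infer_instance
  rw [VectorMeasure.integral_const, signedOccupation, VectorMeasure.map_apply _ hm hA,
    VectorMeasure.restrict_apply _ (hm hA) MeasurableSet.univ, univ_inter]
  simp

/-- The absolute occupation measure as an integral against `|V^c(ds)|`. -/
theorem absOccupation_apply {V : ℝ≥0 → ℝ} (hc : IsCadlag V)
    (hV : LocallyBoundedVariationOn V univ) (t : ℝ≥0) {A : Set ℝ} (hA : MeasurableSet A) :
    absOccupation V hc hV t A
      = ∫⁻ s, A.indicator (fun _ => (1 : ℝ≥0∞)) (V s)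
          ∂(continuousPartMeasure V hc hV t).totalVariation := by
  have hm := measurable_of_locallyBoundedVariationOn hV
  have : (fun s => A.indicator (fun _ => (1 : ℝ≥0∞)) (V s)) = (V ⁻¹' A).indicator 1 := rfl
  rw [this, lintegral_indicator_one (hm hA), absOccupation, Measure.map_apply hm hA]

/-- The set `I(x)` of times at which `V` increases through the level `x`: `V` is continuous at `t`
with `V(t) = x`, and `V(s) - V(t)` has the same (strict) sign as `s - t` for all `s` close
to `t`. -/
def increaseTimes (V : ℝ≥0 → ℝ) (x : ℝ) : Set ℝ≥0 :=
  {t | 0 < t ∧ V t = x ∧ ContinuousAt V t ∧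
    ∀ᶠ s in 𝓝 t, SignType.sign (V s - V t) = SignType.sign ((s : ℝ) - (t : ℝ))}

/-- The set `D(x)` of times at which `V` decreases through the level `x`: the times at which `-V`
increases through the level `-x`. -/
def decreaseTimes (V : ℝ≥0 → ℝ) (x : ℝ) : Set ℝ≥0 :=
  increaseTimes (fun s => -V s) (-x)

/-- `ℓ^x(t)`, the number of increases minus the number of decreases of `V` through the level `x` on
`(0, t]`; it is meaningful when both numbers are finite. -/
def signedLocalTime (V : ℝ≥0 → ℝ) (x : ℝ) (t : ℝ≥0) : ℝ :=
  ((Ioc 0 t ∩ increaseTimes V x).ncard : ℝ) - ((Ioc 0 t ∩ decreaseTimes V x).ncard : ℝ)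

/-- `λ^x(t)`, the number (possibly infinite) of increases plus the number of decreases of `V`
through the level `x` on `(0, t]`. -/
def absLocalTime (V : ℝ≥0 → ℝ) (x : ℝ) (t : ℝ≥0) : ℝ≥0∞ :=
  (((Ioc 0 t ∩ increaseTimes V x).encard + (Ioc 0 t ∩ decreaseTimes V x).encard : ℕ∞) : ℝ≥0∞)

end FiniteVariation

end

namespace FiniteVariation

/-! Run `V` on the clock `a(s) = s +` (variation of `V` on `[0, s]`). The clock is strictly
increasing and right-continuous, and `V = W ∘ a` with `W` 1-Lipschitz on the line. The problem thus
becomes one about `W`, with two ingredients.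

Density: `V(s) - V(0)` is the integral of `W'` over `[a(0), a(s)]`. The values skipped by `a` fill
the gaps `[a(r-), a(r))`, and `W'` integrates to the jump of `V` at `r` over such a gap. What
remains, the integral over `a([0, s])`, is therefore the increment of the continuous part
(`continuousPart_sub_eq_integral`). Hence `V^c(ds)` has density `W'(a(s))` with respect to the
pull-back of Lebesgue measure under `a` (`continuousPartMeasure_eq_withDensityᵥ`).

Counting: almost every level `x` is a regular value of `W` (`ae_forall_deriv_ne_zero`) and is not
taken by `V` at any of the countably many discontinuities of `a`. At such a level, `V` increases
(decreases) through `x` exactly at the times `r` with `V(r) = x` and `W'(a(r)) > 0` (`< 0`), by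
`ae_encard_eq`. The area formula (`lintegral_encard_inter_fiber`) on `{W' > 0}` and `{W' < 0}`
equates the integrals of these counts over `A` with those of the positive and negative parts of `W'`
over `V⁻¹(A)`. Difference and sum give the two densities. -/

/-- A right-continuous function with finite variation is a Lipschitz function of a strictly
increasing right-continuous time change. -/
theorem exists_lipschitz_timeChange {V : ℝ≥0 → ℝ} (hr : ∀ t, ContinuousWithinAt V (Ici t) t)
    (hV : LocallyBoundedVariationOn V univ) :
    ∃ (a : ℝ≥0 → ℝ) (W : ℝ → ℝ), StrictMono a ∧ (∀ t, ContinuousWithinAt a (Ici t) t) ∧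
      LipschitzWith 1 W ∧ ∀ s, W (a s) = V s := by
  -- The variation dominates the increments of `V`, which makes `V ∘ a⁻¹` 1-Lipschitz on the range
  -- of `a`; the term `s` makes `a` injective.
  let a : ℝ≥0 → ℝ := fun s => (s : ℝ) + variationOnFromTo V univ 0 s
  have hmono : Monotone (variationOnFromTo V univ 0) :=
    monotoneOn_univ.1 (variationOnFromTo.monotoneOn hV (mem_univ _))
  have ha : StrictMono a := fun p q hpq =>
    add_lt_add_of_lt_of_le (NNReal.coe_lt_coe.2 hpq) (hmono hpq.le)
  have hle : ∀ p q, p ≤ q → |V q - V p| ≤ a q - a p := fun p q hpq => by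
    have h := variationOnFromTo.abs_sub_le_sub_of_le hV (mem_univ 0) (mem_univ p) (mem_univ q) hpq
    have h' : (p : ℝ) ≤ q := hpq
    simp only [a]
    linarith
  have hlip : LipschitzOnWith 1 (V ∘ Function.invFun a) (range a) := by
    refine LipschitzOnWith.of_dist_le_mul ?_
    rintro _ ⟨p, rfl⟩ _ ⟨q, rfl⟩
    simp only [Function.comp_apply, Function.leftInverse_invFun ha.injective _, NNReal.coe_one,
      one_mul, Real.dist_eq]
    rcases le_total p q with h | h
    · rw [abs_sub_comm, abs_sub_comm (a p)]
      exact (hle p q h).trans (le_abs_self _)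
    · exact (hle q p h).trans (le_abs_self _)
  obtain ⟨W, hW, hWV⟩ := hlip.extend_real
  refine ⟨a, W, ha, fun t => ?_, hW, fun s => ?_⟩
  · refine NNReal.continuous_coe.continuousWithinAt.add ?_
    have h := variationOnFromTo.tendsto_right (s := univ) (mem_univ 0) (mem_univ t) hV
      (l := V t) (by
        rw [univ_inter]
        exact (hr t).mono_left (nhdsWithin_mono _ Ioi_subset_Ici_self))
    rw [← continuousWithinAt_Ioi_iff_Ici]
    simpa [ContinuousWithinAt] using h
  · rw [← hWV (mem_range_self s)]
    simp [Function.leftInverse_invFun ha.injective _]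

/-! ### Jumps of `V` as gaps in the range of the clock -/

section TimeChange

variable {a : ℝ≥0 → ℝ}

/-- By right-continuity the infimum of the times `r` with `u ≤ a r` is attained, and a skipped value
`u` lies in the gap at that time. Strict monotonicity keeps the left endpoint of a gap out of the
range; at continuity points of `a` the interval is empty. -/
theorem biUnion_Ico_leftLim_eq (ha : StrictMono a)
    (har : ∀ t, ContinuousWithinAt a (Ici t) t) (s : ℝ≥0) :
    ⋃ r ∈ Ioc 0 s, Ico (Function.leftLim a r) (a r) = Icc (a 0) (a s) \ a '' Icc 0 s := by
  ext u
  simp only [mem_iUnion, exists_prop]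
  constructor
  · rintro ⟨r, hr, hu⟩
    refine ⟨⟨(ha.monotone.le_leftLim hr.1).trans hu.1, hu.2.le.trans (ha.monotone hr.2)⟩, ?_⟩
    rintro ⟨q, -, rfl⟩
    obtain ⟨p, hqp, hpr⟩ := exists_between (ha.lt_iff_lt.1 hu.2)
    exact ((ha hqp).trans_le (ha.monotone.le_leftLim hpr)).not_ge hu.1
  · rintro ⟨hu, hua⟩
    set S : Set ℝ≥0 := {r | u ≤ a r} with hS
    have hsS : s ∈ S := hu.2
    have hrs : sInf S ≤ s := csInf_le' hsS
    have hur : u ≤ a (sInf S) := by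
      by_contra! h
      have h1 : ∀ᶠ q in 𝓝[≥] sInf S, a q < u := (har _).eventually (gt_mem_nhds h)
      obtain ⟨q, hq, hqS⟩ := (mem_nhdsGE_iff_exists_Ico_subset).1 h1
      obtain ⟨p, hp, hpq⟩ := exists_lt_of_csInf_lt ⟨s, hsS⟩ hq
      have h2 : a p < u := hqS ⟨csInf_le' hp, hpq⟩
      have h3 : u ≤ a p := hp
      exact h2.not_ge h3
    have hne : u ≠ a (sInf S) := fun h => hua ⟨_, ⟨bot_le, hrs⟩, h.symm⟩
    have hpos : 0 < sInf S := by
      refine pos_iff_ne_zero.2 fun h => hne (le_antisymm hur ?_)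
      rw [h]
      exact hu.1
    refine ⟨sInf S, ⟨hpos, hrs⟩, ?_, lt_of_le_of_ne hur hne⟩
    have : (𝓝[<] sInf S).NeBot := nhdsLT_neBot_of_exists_lt ⟨0, hpos⟩
    refine le_of_tendsto (ha.monotone.tendsto_leftLim _) ?_
    filter_upwards [self_mem_nhdsWithin] with q hq
    have h : q ∉ S := notMem_of_lt_csInf' hq
    exact (not_le.1 h).le

theorem measurableEmbedding_of_strictMono (ha : StrictMono a) : MeasurableEmbedding a :=
  ha.monotone.measurable.measurableEmbedding ha.injective

variable {V : ℝ≥0 → ℝ} {W : ℝ → ℝ}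

theorem jump_eq_sub (ha : StrictMono a) (hW : LipschitzWith 1 W) (hWV : ∀ s, W (a s) = V s)
    {r : ℝ≥0} (hr : 0 < r) : jump V r = W (a r) - W (Function.leftLim a r) := by
  have : (𝓝[<] r).NeBot := nhdsLT_neBot_of_exists_lt ⟨0, hr⟩
  have h : Tendsto V (𝓝[<] r) (𝓝 (W (Function.leftLim a r))) := by
    refine ((hW.continuous.tendsto _).comp (ha.monotone.tendsto_leftLim r)).congr fun s => ?_
    exact hWV s
  rw [jump, leftLim_eq_of_tendsto h, hWV]

theorem locallyIntegrable_deriv (hW : LipschitzWith 1 W) : LocallyIntegrable (deriv W) := by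
  refine (locallyIntegrable_const (1 : ℝ)).mono (measurable_deriv W).aestronglyMeasurable ?_
  filter_upwards with x
  simpa using norm_deriv_le_of_lipschitz (x₀ := x) hW

theorem integral_Icc_deriv (hW : LipschitzWith 1 W) {p q : ℝ} (hpq : p ≤ q) :
    ∫ u in Icc p q, deriv W u = W q - W p := by
  rw [integral_Icc_eq_integral_Ioc, ← intervalIntegral.integral_of_le hpq]
  exact hW.lipschitzOnWith.absolutelyContinuousOnInterval.integral_deriv_eq_sub

/-- The fundamental theorem of calculus for `W` on `[a 0, a s]` recovers the whole increment of `V`;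
the complement of `a '' Icc 0 s` accounts for the jumps, gap by gap. -/
theorem continuousPart_sub_eq_integral (ha : StrictMono a)
    (har : ∀ t, ContinuousWithinAt a (Ici t) t) (hW : LipschitzWith 1 W)
    (hWV : ∀ s, W (a s) = V s) (s : ℝ≥0) :
    continuousPart V s - V 0 = ∫ u in a '' Icc 0 s, deriv W u := by
  have hint : IntegrableOn (deriv W) (Icc (a 0) (a s)) :=
    (locallyIntegrable_deriv hW).integrableOn_isCompact isCompact_Icc
  have hsub : a '' Icc 0 s ⊆ Icc (a 0) (a s) := by
    rintro _ ⟨r, hr, rfl⟩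
    exact ⟨ha.monotone hr.1, ha.monotone hr.2⟩
  have hmeas : MeasurableSet (a '' Icc 0 s) :=
    (measurableEmbedding_of_strictMono ha).measurableSet_image.2 measurableSet_Icc
  have hdiff := setIntegral_sdiff hmeas hint hsub
  rw [integral_Icc_deriv hW (ha.monotone (zero_le : (0 : ℝ≥0) ≤ s)), hWV, hWV] at hdiff
  suffices h : discontinuousPart V s = ∫ u in Icc (a 0) (a s) \ a '' Icc 0 s, deriv W u by
    rw [continuousPart, h, hdiff]
    ring
  -- Countable additivity needs a countable index set, so only the nonempty gaps are kept. Elsewhere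
  -- in `Ioc 0 s` the left limit of `a` is its value and `V` has no jump, so the sum of jumps is
  -- unchanged.
  set D : Set ℝ≥0 := {r | r ∈ Ioc 0 s ∧ Function.leftLim a r ≠ a r} with hD
  have hDc : D.Countable := by
    refine ha.monotone.countable_not_continuousAt.mono ?_
    rintro r ⟨-, hr⟩ (h : ContinuousAt a r)
    exact hr <| (ha.monotone.continuousWithinAt_Iio_iff_leftLim_eq).1 h.continuousWithinAt
  have hunion : ⋃ r : D, Ico (Function.leftLim a r) (a r) = Icc (a 0) (a s) \ a '' Icc 0 s := by
    rw [← biUnion_Ico_leftLim_eq ha har, iUnion_coe_set]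
    ext u
    simp only [mem_iUnion, exists_prop]
    constructor
    · rintro ⟨r, hr, hu⟩
      exact ⟨r, hr.1, hu⟩
    · rintro ⟨r, hr, hu⟩
      exact ⟨r, ⟨hr, (hu.1.trans_lt hu.2).ne⟩, hu⟩
  have hdisj : Pairwise (Function.onFun Disjoint
      fun r : D => Ico (Function.leftLim a r) (a (r : ℝ≥0))) := by
    have key : ∀ r r' : D, (r : ℝ≥0) < r' →
        Disjoint (Ico (Function.leftLim a r) (a (r : ℝ≥0)))
          (Ico (Function.leftLim a r') (a (r' : ℝ≥0))) := fun r r' h => by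
      refine Set.disjoint_left.2 fun u hu hu' => ?_
      exact (hu.2.trans_le (ha.monotone.le_leftLim h)).not_ge hu'.1
    intro r r' hne
    rcases lt_or_gt_of_ne (Subtype.coe_ne_coe.2 hne) with h | h
    · exact key r r' h
    · exact (key r' r h).symm
  have : Countable D := hDc
  have hsum := hasSum_integral_iUnion (f := deriv W) (μ := volume)
    (fun r : D => measurableSet_Ico) hdisj
    (by rw [hunion]; exact hint.mono_set sdiff_subset)
  rw [hunion] at hsum
  rw [← hsum.tsum_eq, discontinuousPart, tsum_subtype (Ioc 0 s) (jump V)]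
  have hterm : ∀ r : D, ∫ u in Ico (Function.leftLim a r) (a (r : ℝ≥0)), deriv W u = jump V r := by
    intro r
    rw [integral_Ico_eq_integral_Ioc, ← integral_Icc_eq_integral_Ioc,
      integral_Icc_deriv hW (ha.monotone.leftLim_le le_rfl), jump_eq_sub ha hW hWV r.2.1.1]
  simp only [hterm]
  rw [tsum_subtype D (jump V)]
  congr 1
  ext r
  by_cases hr : r ∈ Ioc 0 s
  · by_cases hr' : r ∈ D
    · rw [indicator_of_mem hr, indicator_of_mem hr']
    · have h : Function.leftLim a r = a r := by
        by_contra h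
        exact hr' ⟨hr, h⟩
      rw [indicator_of_mem hr, indicator_of_notMem hr', jump_eq_sub ha hW hWV hr.1, h, sub_self]
  · rw [indicator_of_notMem hr, indicator_of_notMem fun h => hr h.1]

end TimeChange

/-! ### Area formula with multiplicity and critical values in dimension one -/

section AreaFormula

variable {f f' : ℝ → ℝ} {s : Set ℝ}

/-- On each piece `f` is linear up to an error of at most half the slope, which forces injectivity.
-/
theorem exists_partition_injOn (hf' : ∀ x ∈ s, HasDerivAt f (f' x) x)
    (hne : ∀ x ∈ s, f' x ≠ 0) :
    ∃ T : ℕ → Set ℝ, Pairwise (Function.onFun Disjoint T) ∧ (∀ n, MeasurableSet (T n)) ∧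
      s ⊆ ⋃ n, T n ∧ ∀ n, InjOn f (s ∩ T n) := by
  classical
  rcases s.eq_empty_or_nonempty with rfl | hs
  · exact ⟨fun _ => ∅, fun _ _ _ => disjoint_bot_left, fun _ => .empty, empty_subset _, by simp⟩
  -- The tolerance must be positive for every linear map; the value 1 at zero slope is a dummy,
  -- since the maps obtained below are derivatives at points of `s`.
  let r : (ℝ →L[ℝ] ℝ) → ℝ≥0 := fun A => if A 1 = 0 then 1 else ‖A 1‖₊ / 2
  obtain ⟨T, A, hd, hm, hT, happ, hA⟩ :=
    exists_partition_approximatesLinearOn_of_hasFDerivWithinAt f s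
      (fun x => ContinuousLinearMap.toSpanSingleton ℝ (f' x))
      (fun x hx => (hf' x hx).hasFDerivAt.hasFDerivWithinAt) r (fun A => by
        by_cases h : A 1 = 0 <;> simp [r, h])
  refine ⟨T, hd, hm, hT, fun n x hx y hy hxy => ?_⟩
  obtain ⟨z, hz, hAz⟩ := hA hs n
  have hA1 : A n 1 ≠ 0 := by simpa [hAz] using hne z hz
  have h := happ n x hx y hy
  have hlin : A n (x - y) = (x - y) * A n 1 := by
    rw [← smul_eq_mul, ← map_smul, smul_eq_mul, mul_one]
  -- With `f x = f y` the approximation reads `|x - y| * |slope| ≤ |slope| / 2 * |x - y|`.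
  rw [hxy, sub_self, zero_sub, norm_neg, hlin, norm_mul] at h
  simp only [r, hA1, if_false, NNReal.coe_div, coe_nnnorm, NNReal.coe_ofNat] at h
  have hpos : 0 < ‖A n 1‖ := norm_pos_iff.2 hA1
  have h0 : ‖x - y‖ = 0 := by
    refine le_antisymm ?_ (norm_nonneg _)
    nlinarith [norm_nonneg (x - y)]
  exact sub_eq_zero.1 (norm_eq_zero.1 h0)

/-- Each piece meets the fibre in at most one point. The multiplicity becomes a series of indicators
of images, which are measurable because `f` is injective on each piece. -/
theorem encard_inter_fiber_eq_tsum (hf : Measurable f) (hs : MeasurableSet s) {T : ℕ → Set ℝ}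
    (hd : Pairwise (Function.onFun Disjoint T)) (hm : ∀ n, MeasurableSet (T n))
    (hT : s ⊆ ⋃ n, T n) (hinj : ∀ n, InjOn f (s ∩ T n)) (x : ℝ) :
    ((s ∩ f ⁻¹' {x}).encard : ℝ≥0∞) = ∑' n, (f '' (s ∩ T n)).indicator 1 x := by
  have hmeas : ∀ n, MeasurableSet (s ∩ T n ∩ f ⁻¹' {x}) := fun n =>
    (hs.inter (hm n)).inter (hf (measurableSet_singleton x))
  have hU : s ∩ f ⁻¹' {x} = ⋃ n, s ∩ T n ∩ f ⁻¹' {x} := by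
    rw [← iUnion_inter, ← inter_iUnion, inter_eq_left.2 hT]
  rw [← Measure.count_apply (hs.inter (hf (measurableSet_singleton x))), hU,
    measure_iUnion (fun i j hij => ((hd hij).mono (inter_subset_left.trans inter_subset_right)
      (inter_subset_left.trans inter_subset_right))) hmeas]
  congr 1
  ext n
  rw [Measure.count_apply (hmeas n)]
  by_cases hx : x ∈ f '' (s ∩ T n)
  · obtain ⟨u, hu, rfl⟩ := hx
    have : s ∩ T n ∩ f ⁻¹' {f u} = {u} := by
      ext v
      constructor
      · rintro ⟨hv, hvu⟩
        exact hinj n hv hu hvu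
      · rintro rfl
        exact ⟨hu, rfl⟩
    rw [this, indicator_of_mem (mem_image_of_mem f hu)]
    simp
  · have : s ∩ T n ∩ f ⁻¹' {x} = ∅ := by
      ext v
      simp only [mem_empty_iff_false, iff_false]
      rintro ⟨hv, hvx⟩
      exact hx ⟨v, hv, hvx⟩
    rw [this, indicator_of_notMem hx]
    simp

theorem measurable_encard_inter_fiber (hf : Measurable f) (hs : MeasurableSet s)
    (hf' : ∀ x ∈ s, HasDerivAt f (f' x) x) (hne : ∀ x ∈ s, f' x ≠ 0) :
    Measurable fun x => ((s ∩ f ⁻¹' {x}).encard : ℝ≥0∞) := by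
  obtain ⟨T, hd, hm, hT, hinj⟩ := exists_partition_injOn hf' hne
  simp only [encard_inter_fiber_eq_tsum hf hs hd hm hT hinj]
  exact Measurable.tsum fun n => measurable_one.indicator
    ((hs.inter (hm n)).image_of_measurable_injOn hf (hinj n))

/-- The area formula with multiplicities, on a set where the derivative does not vanish. -/
theorem lintegral_encard_inter_fiber (hf : Measurable f) (hs : MeasurableSet s)
    (hf' : ∀ x ∈ s, HasDerivAt f (f' x) x) (hne : ∀ x ∈ s, f' x ≠ 0) {A : Set ℝ}
    (hA : MeasurableSet A) :
    ∫⁻ x in A, ((s ∩ f ⁻¹' {x}).encard : ℝ≥0∞) = ∫⁻ u in s ∩ f ⁻¹' A, ENNReal.ofReal |f' u| := by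
  obtain ⟨T, hd, hm, hT, hinj⟩ := exists_partition_injOn hf' hne
  have himg : ∀ n, MeasurableSet (f '' (s ∩ T n)) := fun n =>
    (hs.inter (hm n)).image_of_measurable_injOn hf (hinj n)
  have hpiece : ∀ n, ∫⁻ x in A, (f '' (s ∩ T n)).indicator 1 x
      = ∫⁻ u in s ∩ f ⁻¹' A ∩ T n, ENNReal.ofReal |f' u| := fun n => by
    -- The injective change of variables with integrand 1 computes the length of `f '' (s ∩ T n) ∩
    -- A`.
    have h := lintegral_image_eq_lintegral_abs_deriv_mul (s := s ∩ T n ∩ f ⁻¹' A)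
      ((hs.inter (hm n)).inter (hf hA)) (fun x hx => (hf' x hx.1.1).hasDerivWithinAt)
      ((hinj n).mono inter_subset_left) 1
    simp only [Pi.one_apply, mul_one] at h
    rw [lintegral_indicator_one (himg n), Measure.restrict_apply (himg n), ← image_inter_preimage,
      ← setLIntegral_one, h, inter_right_comm]
  simp only [encard_inter_fiber_eq_tsum hf hs hd hm hT hinj]
  rw [lintegral_tsum fun n => (measurable_one.indicator (himg n)).aemeasurable]
  simp only [hpiece]
  rw [← lintegral_iUnion (fun n => (hs.inter (hf hA)).inter (hm n))
    (fun i j hij => (hd hij).mono inter_subset_right inter_subset_right), ← inter_iUnion,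
    inter_eq_left.2 (inter_subset_left.trans hT)]

/-- Almost every level of a Lipschitz function is a regular value. -/
theorem ae_forall_deriv_ne_zero {K : ℝ≥0} (hf : LipschitzWith K f) :
    ∀ᵐ x : ℝ, ∀ u, f u = x → deriv f u ≠ 0 := by
  -- Rademacher's theorem, together with the fact that Lipschitz maps preserve null sets. As `deriv`
  -- is 0 at points of non-differentiability, these levels must be discarded along with the critical
  -- values of `h2`.
  have h1 : volume (f '' {u | ¬ DifferentiableAt ℝ f u}) = 0 := by
    have h := hf.hausdorffMeasure_image_le (d := 1) zero_le_one {u | ¬ DifferentiableAt ℝ f u}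
    have h0 : volume {u | ¬ DifferentiableAt ℝ f u} = 0 := hf.ae_differentiableAt_real
    rw [hausdorffMeasure_real, h0, mul_zero] at h
    exact le_antisymm h zero_le
  have h2 : volume (f '' {u | DifferentiableAt ℝ f u ∧ deriv f u = 0}) = 0 := by
    refine addHaar_image_eq_zero_of_det_fderivWithin_eq_zero volume
      (f' := fun u => ContinuousLinearMap.toSpanSingleton ℝ (deriv f u)) (fun u hu => ?_)
      (fun u hu => ?_)
    · exact hu.1.hasDerivAt.hasFDerivAt.hasFDerivWithinAt
    · rw [hu.2]
      simp
  filter_upwards [measure_eq_zero_iff_ae_notMem.1 h1, measure_eq_zero_iff_ae_notMem.1 h2]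
    with x hx1 hx2 u hu h0
  by_cases hd : DifferentiableAt ℝ f u
  · exact hx2 ⟨u, ⟨hd, h0⟩, hu⟩
  · exact hx1 ⟨u, hd, hu⟩

end AreaFormula

/-! ### Density of the Stieltjes measure with respect to the clock -/

section StieltjesMeasure

variable {a : ℝ≥0 → ℝ} {V : ℝ≥0 → ℝ} {W : ℝ → ℝ}

/-- The image of Lebesgue measure, restricted to the values taken on `(0, t]` by the time change
`a`, under the inverse of `a`. -/
noncomputable def clockMeasure (a : ℝ≥0 → ℝ) (t : ℝ≥0) : Measure ℝ≥0 :=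
  (Measure.comap a volume).restrict (Ioc 0 t)

/-- Since `a` is a measurable embedding, pulling Lebesgue measure back and pushing it forward again
only restricts it to the range. This turns integrals over times into integrals over clock values. -/
theorem map_restrict_clockMeasure (ha : StrictMono a) (t : ℝ≥0) {S : Set ℝ≥0}
    (hS : MeasurableSet S) :
    ((clockMeasure a t).restrict S).map a = volume.restrict (a '' (Ioc 0 t ∩ S)) := by
  have hemb := measurableEmbedding_of_strictMono ha
  rw [clockMeasure, Measure.restrict_restrict hS, inter_comm S]
  have h := hemb.restrict_map (Measure.comap a volume) (a '' (Ioc 0 t ∩ S))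
  rw [preimage_image_eq _ ha.injective, hemb.map_comap, Measure.restrict_restrict
    (hemb.measurableSet_image.2 (measurableSet_Ioc.inter hS)),
    inter_eq_left.2 (image_subset_range _ _)] at h
  exact h.symm

theorem isFiniteMeasure_clockMeasure (ha : StrictMono a) (t : ℝ≥0) :
    IsFiniteMeasure (clockMeasure a t) := by
  have h := map_restrict_clockMeasure ha t MeasurableSet.univ
  rw [Measure.restrict_univ] at h
  refine ⟨?_⟩
  have h' := congrArg (fun μ : Measure ℝ => μ univ) h
  simp only [Measure.map_apply ha.monotone.measurable MeasurableSet.univ, preimage_univ,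
    Measure.restrict_apply_univ] at h'
  rw [h']
  refine (measure_mono (t := Icc (a 0) (a t)) ?_).trans_lt (by simp)
  rintro _ ⟨r, hr, rfl⟩
  exact ⟨ha.monotone hr.1.1.le, ha.monotone hr.1.2⟩

theorem noAtoms_clockMeasure (ha : StrictMono a) (t : ℝ≥0) : NullSingletonClass (clockMeasure a t) := by
  refine ⟨fun s => ?_⟩
  refine le_antisymm ((Measure.restrict_apply_le _ _).trans ?_) zero_le
  rw [(measurableEmbedding_of_strictMono ha).comap_apply, image_singleton, Real.volume_singleton]

theorem setIntegral_clockMeasure (ha : StrictMono a) (t : ℝ≥0) {S : Set ℝ≥0}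
    (hS : MeasurableSet S) (g : ℝ → ℝ) :
    ∫ r in S, g (a r) ∂clockMeasure a t = ∫ u in a '' (Ioc 0 t ∩ S), g u := by
  rw [← map_restrict_clockMeasure ha t hS, (measurableEmbedding_of_strictMono ha).integral_map]

theorem setLIntegral_clockMeasure (ha : StrictMono a) (t : ℝ≥0) {S : Set ℝ≥0}
    (hS : MeasurableSet S) (g : ℝ → ℝ≥0∞) :
    ∫⁻ r in S, g (a r) ∂clockMeasure a t = ∫⁻ u in a '' (Ioc 0 t ∩ S), g u := by
  rw [← map_restrict_clockMeasure ha t hS, (measurableEmbedding_of_strictMono ha).lintegral_map]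

theorem integrable_deriv_comp_clockMeasure (ha : StrictMono a) (hW : LipschitzWith 1 W)
    (t : ℝ≥0) : Integrable (fun r => deriv W (a r)) (clockMeasure a t) := by
  have := isFiniteMeasure_clockMeasure ha t
  refine Integrable.of_bound
    ((measurable_deriv W).comp ha.monotone.measurable).aestronglyMeasurable 1 ?_
  filter_upwards with r
  simpa using norm_deriv_le_of_lipschitz (x₀ := a r) hW

theorem continuousPart_min_eq (ha : StrictMono a)
    (har : ∀ t, ContinuousWithinAt a (Ici t) t) (hW : LipschitzWith 1 W)
    (hWV : ∀ s, W (a s) = V s) (t s : ℝ≥0) :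
    continuousPart V (min s t) = V 0 + ∫ r in Iic s, deriv W (a r) ∂clockMeasure a t := by
  rw [setIntegral_clockMeasure ha t measurableSet_Iic (deriv W), ← sub_eq_iff_eq_add',
    continuousPart_sub_eq_integral ha har hW hWV]
  refine setIntegral_congr_set ?_
  -- The two domains of integration differ at most by the point `a 0`.
  have h : a '' Icc 0 (min s t) = insert (a 0) (a '' (Ioc 0 t ∩ Iic s)) := by
    rw [← image_insert_eq]
    congr 1
    ext r
    rcases eq_or_ne r 0 with rfl | hr
    · simp
    · simp [and_comm]
  rw [h]
  exact insert_ae_eq_self _ _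

/-- Dominated convergence: the indicators of `Iic q` converge as `q → s` except at the point `s`,
which is not charged. Continuity makes the one-sided limits in the Stieltjes measure plain values.
-/
theorem continuous_setIntegral_Iic {μ : Measure ℝ≥0} [NullSingletonClass μ] {g : ℝ≥0 → ℝ}
    (hg : Integrable g μ) : Continuous fun s => ∫ r in Iic s, g r ∂μ := by
  simp only [← integral_indicator measurableSet_Iic]
  refine continuous_iff_continuousAt.2 fun s => ?_
  refine continuousAt_of_dominated (bound := fun r => ‖g r‖) ?_ ?_ hg.norm ?_
  · exact Eventually.of_forall fun q => hg.aestronglyMeasurable.indicator measurableSet_Iic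
  · refine Eventually.of_forall fun q => Eventually.of_forall fun r => ?_
    exact norm_indicator_le_norm_self _ _
  · have : ∀ᵐ r ∂μ, r ≠ s := by
      rw [ae_iff]
      simp
    filter_upwards [this] with r hr
    rcases lt_or_gt_of_ne hr with h | h
    · refine (continuousAt_const (y := g r)).congr ?_
      filter_upwards [lt_mem_nhds h] with q hq
      rw [indicator_of_mem (mem_Iic.2 hq.le)]
    · refine (continuousAt_const (y := (0 : ℝ))).congr ?_
      filter_upwards [gt_mem_nhds h] with q hq
      rw [indicator_of_notMem (notMem_Iic.2 hq)]

/-- The Stieltjes measure of the continuous part has density the derivative of the time-changed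
function with respect to the clock. -/
theorem continuousPartMeasure_eq_withDensityᵥ (ha : StrictMono a)
    (har : ∀ t, ContinuousWithinAt a (Ici t) t) (hW : LipschitzWith 1 W)
    (hWV : ∀ s, W (a s) = V s) (hc : IsCadlag V) (hV : LocallyBoundedVariationOn V univ)
    (t : ℝ≥0) :
    continuousPartMeasure V hc hV t
      = (clockMeasure a t).withDensityᵥ fun r => deriv W (a r) := by
  have hint := integrable_deriv_comp_clockMeasure ha hW t
  have := noAtoms_clockMeasure ha t
  have hF := continuousPart_min_eq ha har hW hWV t
  have hcont : Continuous fun s => continuousPart V (min s t) := by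
    simp only [hF]
    exact continuous_const.add (continuous_setIntegral_Iic hint)
  have h0 : clockMeasure a t (Iic 0) = 0 := by
    rw [← Icc_bot, bot_eq_zero, Icc_self, measure_singleton]
  have hF0 : continuousPart V (min 0 t) = V 0 := by
    rw [hF, setIntegral_measure_zero _ h0, add_zero]
  have hBV := boundedVariationOn_stopped (locallyBoundedVariationOn_continuousPart hc hV) t
  rw [continuousPartMeasure, stieltjesUpTo]
  -- The half-lines form a generating π-system, so it suffices to compare the two measures on them
  -- and on the whole space.
  refine VectorMeasure.ext_of_generateFrom (range Iic) ?_
    (by rw [BorelSpace.measurable_eq (α := ℝ≥0), borel_eq_generateFrom_Iic]) isPiSystem_Iic ?_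
  · rintro _ ⟨s, rfl⟩
    rw [withDensityᵥ_apply hint measurableSet_Iic]
    -- `Iic s` is `Icc 0 s`. The left limit at 0, where no earlier time exists, is the value there,
    -- so the Stieltjes measure does not charge 0.
    have h := hBV.vectorMeasure_Icc (zero_le : (0 : ℝ≥0) ≤ s)
    rw [hcont.continuousWithinAt.rightLim_eq, hcont.continuousWithinAt.leftLim_eq, hF0, hF,
      ← bot_eq_zero, Icc_bot] at h
    rw [h]
    ring
  · rw [withDensityᵥ_apply hint MeasurableSet.univ, hBV.vectorMeasure_univ]
    have h1 : Tendsto (fun s => continuousPart V (min s t)) atTop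
        (𝓝 (V 0 + ∫ r in univ, deriv W (a r) ∂clockMeasure a t)) := by
      refine tendsto_const_nhds.congr' ?_
      filter_upwards [eventually_ge_atTop t] with s hs
      rw [hF, setIntegral_clockMeasure ha t measurableSet_Iic (deriv W),
        setIntegral_clockMeasure ha t MeasurableSet.univ (deriv W), inter_univ,
        inter_eq_left.2 fun r hr => hr.2.trans hs]
    -- On `[0, ∞)` the filter `atBot` is concentrated at 0.
    have h2 : Tendsto (fun s => continuousPart V (min s t)) atBot (𝓝 (V 0)) := by
      refine tendsto_const_nhds.congr' ?_
      filter_upwards [eventually_le_atBot 0] with s hs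
      rw [nonpos_iff_eq_zero.1 hs, hF0]
    rw [h1.limUnder_eq, h2.limUnder_eq]
    ring

theorem totalVariation_continuousPartMeasure (ha : StrictMono a)
    (har : ∀ t, ContinuousWithinAt a (Ici t) t) (hW : LipschitzWith 1 W)
    (hWV : ∀ s, W (a s) = V s) (hc : IsCadlag V) (hV : LocallyBoundedVariationOn V univ)
    (t : ℝ≥0) :
    (continuousPartMeasure V hc hV t).totalVariation
      = (clockMeasure a t).withDensity fun r => ‖deriv W (a r)‖ₑ := by
  rw [SignedMeasure.totalVariation_eq_variation,
    continuousPartMeasure_eq_withDensityᵥ ha har hW hWV hc hV t,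
    Measure.variation_withDensityᵥ (integrable_deriv_comp_clockMeasure ha hW t)]

end StieltjesMeasure

/-! ### Passages through a level and signs of `W'` -/

section Counting

variable {a : ℝ≥0 → ℝ} {V : ℝ≥0 → ℝ} {W : ℝ → ℝ}

theorem eventually_sign_sub_eq_of_deriv_pos {u : ℝ} (h : 0 < deriv W u) :
    ∀ᶠ v in 𝓝 u, SignType.sign (W v - W u) = SignType.sign (v - u) := by
  have h' : 0 < deriv (fun v => W v - W u) u := by rwa [deriv_sub_const]
  exact eventually_nhdsWithin_sign_eq_of_deriv_pos h' (sub_self _)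

theorem sign_sub_eq_of_strictMono (ha : StrictMono a) (s r : ℝ≥0) :
    SignType.sign (a s - a r) = SignType.sign ((s : ℝ) - r) := by
  rcases lt_trichotomy s r with h | rfl | h
  · rw [sign_neg (sub_neg.2 (ha h)), sign_neg (sub_neg.2 (NNReal.coe_lt_coe.2 h))]
  · simp
  · rw [sign_pos (sub_pos.2 (ha h)), sign_pos (sub_pos.2 (NNReal.coe_lt_coe.2 h))]

/-- A positive derivative gives `W v - W u` the sign of `v - u` near `u`; this passes to `V = W ∘ a`
because `a` is continuous at the time in question and preserves order. At a regular level the only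
alternative is a negative derivative, which makes `V` decrease there. -/
theorem image_inter_increaseTimes (ha : StrictMono a) (hW : Continuous W)
    (hWV : ∀ s, W (a s) = V s) {x : ℝ} (hreg : ∀ u, W u = x → deriv W u ≠ 0)
    (hcont : ∀ r, V r = x → ContinuousAt a r) (t : ℝ≥0) :
    a '' (Ioc 0 t ∩ increaseTimes V x)
      = a '' Ioc 0 t ∩ {u | 0 < deriv W u} ∩ W ⁻¹' {x} := by
  have key : ∀ r, ContinuousAt a r → 0 < deriv W (a r) →
      ∀ᶠ s in 𝓝 r, SignType.sign (V s - V r) = SignType.sign ((s : ℝ) - r) := fun r hr hd => by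
    filter_upwards [hr.eventually (eventually_sign_sub_eq_of_deriv_pos hd)] with s hs
    rw [← hWV, ← hWV, hs, sign_sub_eq_of_strictMono ha]
  ext u
  constructor
  · rintro ⟨r, ⟨hrt, hr0, hrx, -, hr⟩, rfl⟩
    have hWx : W (a r) = x := (hWV r).trans hrx
    refine ⟨⟨mem_image_of_mem a hrt, ?_⟩, hWx⟩
    by_contra hd
    have hneg : deriv W (a r) < 0 := lt_of_le_of_ne (not_lt.1 hd) (hreg _ hWx)
    have hpos : 0 < deriv (fun v => -W v) (a r) := by
      rw [deriv.fun_neg]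
      exact neg_pos.2 hneg
    have h1 := (hcont r hrx).eventually (eventually_sign_sub_eq_of_deriv_pos hpos)
    -- At a time `s` just after `r`, `V s` would be both above and below `V r`.
    obtain ⟨s, ⟨hs, hs'⟩, hrs⟩ := (((hr.and h1).filter_mono nhdsWithin_le_nhds).and
      (self_mem_nhdsWithin : Ioi r ∈ 𝓝[>] r)).exists
    rw [sign_sub_eq_of_strictMono ha, hWV, hWV, sign_pos (sub_pos.2 (NNReal.coe_lt_coe.2 hrs)),
      sign_eq_one_iff] at hs'
    rw [sign_pos (sub_pos.2 (NNReal.coe_lt_coe.2 hrs)), sign_eq_one_iff] at hs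
    linarith
  · rintro ⟨⟨⟨r, hrt, rfl⟩, hd⟩, hx⟩
    have hrx : V r = x := (hWV r).symm.trans hx
    have hac := hcont r hrx
    refine ⟨r, ⟨hrt, hrt.1, hrx, ?_, key r hac hd⟩, rfl⟩
    have : V = W ∘ a := funext fun s => (hWV s).symm
    rw [this]
    exact hW.continuousAt.comp hac

theorem image_inter_decreaseTimes (ha : StrictMono a) (hW : Continuous W)
    (hWV : ∀ s, W (a s) = V s) {x : ℝ} (hreg : ∀ u, W u = x → deriv W u ≠ 0)
    (hcont : ∀ r, V r = x → ContinuousAt a r) (t : ℝ≥0) :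
    a '' (Ioc 0 t ∩ decreaseTimes V x)
      = a '' Ioc 0 t ∩ {u | deriv W u < 0} ∩ W ⁻¹' {x} := by
  have h := image_inter_increaseTimes (V := fun s => -V s) (W := fun u => -W u) (x := -x) ha hW.neg
    (fun s => by rw [hWV]) (fun u hu => by
      rw [deriv.fun_neg]
      exact neg_ne_zero.2 (hreg u (neg_injective hu))) (fun r hr => hcont r (neg_injective hr)) t
  rw [decreaseTimes, h]
  ext u
  simp [deriv.fun_neg]

theorem ae_encard_eq (ha : StrictMono a) (hW : LipschitzWith 1 W) (hWV : ∀ s, W (a s) = V s)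
    (t : ℝ≥0) :
    ∀ᵐ x : ℝ, (Ioc 0 t ∩ increaseTimes V x).encard
        = (a '' Ioc 0 t ∩ {u | 0 < deriv W u} ∩ W ⁻¹' {x}).encard ∧
      (Ioc 0 t ∩ decreaseTimes V x).encard
        = (a '' Ioc 0 t ∩ {u | deriv W u < 0} ∩ W ⁻¹' {x}).encard := by
  -- The monotone clock has countably many discontinuities, so only countably many levels are lost.
  have hcount : volume (V '' {r | ¬ ContinuousAt a r}) = 0 :=
    (ha.monotone.countable_not_continuousAt.image V).measure_zero volume
  filter_upwards [ae_forall_deriv_ne_zero hW, measure_eq_zero_iff_ae_notMem.1 hcount]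
    with x hreg hx
  have hcont : ∀ r, V r = x → ContinuousAt a r := fun r hr => by
    by_contra h
    exact hx ⟨r, h, hr⟩
  rw [← image_inter_increaseTimes ha hW.continuous hWV hreg hcont,
    ← image_inter_decreaseTimes ha hW.continuous hWV hreg hcont,
    ha.injective.encard_image, ha.injective.encard_image]
  exact ⟨rfl, rfl⟩

theorem setLIntegral_ofReal_eq {g : ℝ → ℝ} (hg : Measurable g) (μ : Measure ℝ) :
    ∫⁻ u, ENNReal.ofReal (g u) ∂μ = ∫⁻ u in {u | 0 < g u}, ENNReal.ofReal |g u| ∂μ := by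
  rw [← lintegral_indicator (measurableSet_lt measurable_const hg)]
  congr 1
  ext u
  by_cases hu : 0 < g u
  · rw [indicator_of_mem (show u ∈ {u | 0 < g u} from hu), abs_of_pos hu]
  · rw [indicator_of_notMem (show u ∉ {u | 0 < g u} from hu), ENNReal.ofReal_of_nonpos (not_lt.1 hu)]

/-- The number of upward passages integrates to the positive part of the Stieltjes measure. -/
theorem lintegral_encard_deriv_pos (ha : StrictMono a) (hW : Continuous W)
    (hWV : ∀ s, W (a s) = V s) (t : ℝ≥0) {A : Set ℝ} (hA : MeasurableSet A) :
    Measurable (fun x =>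
        ((a '' Ioc 0 t ∩ {u | 0 < deriv W u} ∩ W ⁻¹' {x}).encard : ℝ≥0∞)) ∧
      ∫⁻ x in A, ((a '' Ioc 0 t ∩ {u | 0 < deriv W u} ∩ W ⁻¹' {x}).encard : ℝ≥0∞)
        = ∫⁻ r in V ⁻¹' A, ENNReal.ofReal (deriv W (a r)) ∂clockMeasure a t := by
  have hemb := measurableEmbedding_of_strictMono ha
  have hP : MeasurableSet {u | 0 < deriv W u} :=
    measurableSet_lt measurable_const (measurable_deriv W)
  have hQ : MeasurableSet (a '' Ioc 0 t) := hemb.measurableSet_image.2 measurableSet_Ioc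
  have hd : ∀ u ∈ a '' Ioc 0 t ∩ {u | 0 < deriv W u}, HasDerivAt W (deriv W u) u :=
    fun u hu => (differentiableAt_of_deriv_ne_zero hu.2.ne').hasDerivAt
  have hne : ∀ u ∈ a '' Ioc 0 t ∩ {u | 0 < deriv W u}, deriv W u ≠ 0 := fun u hu => hu.2.ne'
  refine ⟨measurable_encard_inter_fiber hW.measurable (hQ.inter hP) hd hne, ?_⟩
  have hVW : V ⁻¹' A = a ⁻¹' (W ⁻¹' A) := by
    ext s
    simp [hWV]
  rw [lintegral_encard_inter_fiber hW.measurable (hQ.inter hP) hd hne hA, hVW,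
    setLIntegral_clockMeasure ha t (hemb.measurable (hW.measurable hA))
      (fun u => ENNReal.ofReal (deriv W u)), setLIntegral_ofReal_eq (measurable_deriv W),
    Measure.restrict_restrict hP, image_inter_preimage]
  congr 2
  ext u
  simp only [mem_inter_iff]
  tauto

theorem lintegral_encard_deriv_neg (ha : StrictMono a) (hW : Continuous W)
    (hWV : ∀ s, W (a s) = V s) (t : ℝ≥0) {A : Set ℝ} (hA : MeasurableSet A) :
    Measurable (fun x =>
        ((a '' Ioc 0 t ∩ {u | deriv W u < 0} ∩ W ⁻¹' {x}).encard : ℝ≥0∞)) ∧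
      ∫⁻ x in A, ((a '' Ioc 0 t ∩ {u | deriv W u < 0} ∩ W ⁻¹' {x}).encard : ℝ≥0∞)
        = ∫⁻ r in V ⁻¹' A, ENNReal.ofReal (-deriv W (a r)) ∂clockMeasure a t := by
  -- Decreases of `V` are increases of `-V`; the levels are reflected, and Lebesgue measure is
  -- invariant under reflection.
  have h := lintegral_encard_deriv_pos (V := fun s => -V s) (W := fun u => -W u) ha hW.neg
    (fun s => by rw [hWV]) t (A := Neg.neg ⁻¹' A) (measurable_neg hA)
  have hfib : ∀ x : ℝ, a '' Ioc 0 t ∩ {u | 0 < deriv (fun u => -W u) u} ∩ (fun u => -W u) ⁻¹' {x}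
      = a '' Ioc 0 t ∩ {u | deriv W u < 0} ∩ W ⁻¹' {-x} := fun x => by
    ext u
    simp [deriv.fun_neg, neg_eq_iff_eq_neg]
  have hpre : (fun s => -V s) ⁻¹' (Neg.neg ⁻¹' A) = V ⁻¹' A := by
    ext s
    simp
  simp only [hfib, hpre] at h
  simp only [deriv.fun_neg] at h
  refine ⟨by simpa [Function.comp_def] using h.1.comp measurable_neg, ?_⟩
  rw [← h.2, ← (Measure.measurePreserving_neg (volume : Measure ℝ)).setLIntegral_comp_preimage_emb
    (MeasurableEquiv.neg ℝ).measurableEmbedding]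

theorem toReal_encard {α : Type*} (s : Set α) : ((s.encard : ℝ≥0∞)).toReal = s.ncard := by
  rw [Set.ncard]
  induction s.encard using ENat.recTopCoe <;> simp

end Counting

end FiniteVariation

/-! ### Occupation densities -/

theorem theorem1 (V : ℝ≥0 → ℝ) (hc : FiniteVariation.IsCadlag V)
    (hV : LocallyBoundedVariationOn V Set.univ) (t : ℝ≥0) (ht : 0 < t) :
    -- both numbers of passages are finite for almost every level
    (∀ᵐ x : ℝ, (Set.Ioc 0 t ∩ FiniteVariation.increaseTimes V x).Finite ∧
      (Set.Ioc 0 t ∩ FiniteVariation.decreaseTimes V x).Finite) ∧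
    -- the signed occupation measure has the integrable density `ℓ^x(t)`
    Integrable (fun x : ℝ => FiniteVariation.signedLocalTime V x t) ∧
    FiniteVariation.signedOccupation V hc hV t =
      (volume : Measure ℝ).withDensityᵥ (fun x : ℝ => FiniteVariation.signedLocalTime V x t) ∧
    -- the absolute occupation measure has the integrable density `λ^x(t)`
    AEMeasurable (fun x : ℝ => FiniteVariation.absLocalTime V x t) ∧
    ∫⁻ x : ℝ, FiniteVariation.absLocalTime V x t < ∞ ∧
    FiniteVariation.absOccupation V hc hV t =
      (volume : Measure ℝ).withDensity (fun x : ℝ => FiniteVariation.absLocalTime V x t) := by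
  open FiniteVariation in
  obtain ⟨a, W, ha, har, hW, hWV⟩ := exists_lipschitz_timeChange hc.right_continuous hV
  have hVm := measurable_of_locallyBoundedVariationOn hV
  have hint := integrable_deriv_comp_clockMeasure ha hW t
  have hcount := ae_encard_eq ha hW hWV t
  set N : ℝ → ℝ≥0∞ := fun x =>
    ((a '' Ioc 0 t ∩ {u | 0 < deriv W u} ∩ W ⁻¹' {x}).encard : ℝ≥0∞) with hN
  set M : ℝ → ℝ≥0∞ := fun x =>
    ((a '' Ioc 0 t ∩ {u | deriv W u < 0} ∩ W ⁻¹' {x}).encard : ℝ≥0∞) with hM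
  have hNm : Measurable N := (lintegral_encard_deriv_pos ha hW.continuous hWV t .univ).1
  have hMm : Measurable M := (lintegral_encard_deriv_neg ha hW.continuous hWV t .univ).1
  have hNA : ∀ A, MeasurableSet A → ∫⁻ x in A, N x
      = ∫⁻ r in V ⁻¹' A, ENNReal.ofReal (deriv W (a r)) ∂clockMeasure a t :=
    fun A hA => (lintegral_encard_deriv_pos ha hW.continuous hWV t hA).2
  have hMA : ∀ A, MeasurableSet A → ∫⁻ x in A, M x
      = ∫⁻ r in V ⁻¹' A, ENNReal.ofReal (-deriv W (a r)) ∂clockMeasure a t :=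
    fun A hA => (lintegral_encard_deriv_neg ha hW.continuous hWV t hA).2
  -- The total number of passages, integrated over levels, is the integral of a part of `W' ∘ a`
  -- against the finite clock measure; almost everywhere finiteness follows.
  have hNfin : ∫⁻ x, N x ≠ ∞ := by
    rw [← setLIntegral_univ, hNA _ .univ, preimage_univ, setLIntegral_univ]
    exact hint.lintegral_lt_top.ne
  have hMfin : ∫⁻ x, M x ≠ ∞ := by
    rw [← setLIntegral_univ, hMA _ .univ, preimage_univ, setLIntegral_univ]
    exact hint.neg.lintegral_lt_top.ne
  have hNlt := ae_lt_top hNm hNfin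
  have hMlt := ae_lt_top hMm hMfin
  have habs : (fun x => absLocalTime V x t) =ᵐ[volume] fun x => N x + M x := by
    filter_upwards [hcount] with x hx
    simp only [absLocalTime, hx.1, hx.2, hN, hM]
    simp
  have hsgn : (fun x => signedLocalTime V x t)
      =ᵐ[volume] fun x => (N x).toReal - (M x).toReal := by
    filter_upwards [hcount] with x hx
    simp only [signedLocalTime, ← toReal_encard, hx.1, hx.2, hN, hM]
  have hNint : Integrable fun x => (N x).toReal := integrable_toReal_of_lintegral_ne_top
    hNm.aemeasurable hNfin
  have hMint : Integrable fun x => (M x).toReal := integrable_toReal_of_lintegral_ne_top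
    hMm.aemeasurable hMfin
  have hsint : Integrable fun x => signedLocalTime V x t := (hNint.sub hMint).congr hsgn.symm
  refine ⟨?_, hsint, ?_, (hNm.add hMm).aemeasurable.congr habs.symm, ?_, ?_⟩
  · filter_upwards [hcount, hNlt, hMlt] with x hx h1 h2
    rw [← encard_lt_top_iff, ← encard_lt_top_iff, hx.1, hx.2]
    exact ⟨by simpa [hN] using h1, by simpa [hM] using h2⟩
  -- Both sides equal the integral of the positive part of `W' ∘ a` over `V⁻¹(A)` minus that of its
  -- negative part.
  · ext A hA
    have h1 : ∀ S : Set ℝ, ∫ x in S, (N x).toReal = (∫⁻ x in S, N x).toReal := fun S =>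
      integral_toReal hNm.aemeasurable (ae_restrict_of_ae hNlt)
    have h2 : ∀ S : Set ℝ, ∫ x in S, (M x).toReal = (∫⁻ x in S, M x).toReal := fun S =>
      integral_toReal hMm.aemeasurable (ae_restrict_of_ae hMlt)
    rw [withDensityᵥ_apply hsint hA, setIntegral_congr_ae hA (hsgn.mono fun x hx _ => hx),
      integral_sub hNint.integrableOn hMint.integrableOn, h1, h2, hNA A hA, hMA A hA,
      signedOccupation, VectorMeasure.map_apply _ hVm hA,
      continuousPartMeasure_eq_withDensityᵥ ha har hW hWV, withDensityᵥ_apply hint (hVm hA),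
      integral_eq_lintegral_pos_part_sub_lintegral_neg_part hint.integrableOn]
  · rw [lintegral_congr_ae habs, lintegral_add_left hNm]
    exact ENNReal.add_lt_top.2 ⟨hNfin.lt_top, hMfin.lt_top⟩
  -- Here the two parts add up to `|W' ∘ a|`, the density of the total variation measure.
  · ext A hA
    rw [withDensity_congr_ae habs, withDensity_apply _ hA, lintegral_add_left hNm, hNA A hA,
      hMA A hA, absOccupation, Measure.map_apply hVm hA,
      totalVariation_continuousPartMeasure ha har hW hWV, withDensity_apply _ (hVm hA),
      ← lintegral_add_left (by exact
        ((measurable_deriv W).comp ha.monotone.measurable).ennreal_ofReal)]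
    refine lintegral_congr fun r => ?_
    rw [← ofReal_norm, Real.norm_eq_abs]
    rcases le_total 0 (deriv W (a r)) with h | h
    · rw [abs_of_nonneg h, ENNReal.ofReal_of_nonpos (neg_nonpos.2 h), add_zero]
    · rw [abs_of_nonpos h, ENNReal.ofReal_of_nonpos h, zero_add]
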